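/- Let $G=(V,E)$ be a finite connected graph, possibly with parallel edges and loops, and replace each edge by two opposite oriented edges $e,\bar e$; let $\mathbb E$ be the set of oriented edges. Let $\mathcal H$ be the real vector space of flows in $G$, that is, of functions $x:\mathbb E\to\mathbb R$ with $x_{\bar e}=-x_e$ for all $e\in\mathbb E$ and $\sum_{e \text{ with tail } v}x_e=0$ for every vertex $v$. Let $\Lambda\subset\mathcal H$ be the lattice of integer-valued flows. Put $\langle x,y\rangle=\sum_{e\in E}x_ey_e$ (one orientation chosen for each edge; each edge counted once) and $q(x)=\langle x,x\rangle$. The covering number $\mathrm{Cov}(\Lambda)$ is the smallest real number $r$ such that for every $x\in\mathcal H$ there is $m\in\Lambda$ with $q(x-m)\le r$. A strongly connected orientation of $G$ means an orientation $D$ of the graph obtained from $G$ by deleting all its bridges such that, inside each connected component of that graph, any vertex can be reached from any other along $D$. For a circuit $C$ (an orientation of a cycle; loops and pairs of parallel edges give cycles), let $\ell(C)$ be its number of edges and $x^C\in\Lambda$ the flow that is $1$ on the oriented edges of $C$, $-1$ on their inverses, and $0$ elsewhere. Let $\Delta(f)(y)=\sum_{e\text{ with tail }y}\bigl(f(y)-f(\mathrm{head}(e))\bigr)$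 be the Laplacian of $G$ on functions $f:V\to\mathbb R$, with $\langle f,g\rangle=\sum_{y\in V}f(y)g(y)$ for such functions, and let $d^{\mathrm{out}}$, $d^{\mathrm{in}}$ be the out- and in-degree functions of $D$. Let $\epsilon$ be the number of edges of $G$ that are not bridges. Then the smallest $r$ defining $\mathrm{Cov}(\Lambda)$ exists, and the following hold. 1. For every strongly connected orientation $D$ of $G$ there is a unique $v^D\in\mathcal H$ with $2\langle v^D,x^C\rangle=\ell(C)$ for all circuits $C\subset D$, and $\mathrm{Cov}(\Lambda)$ is the maximum of $q(v^D)$ over all strongly connected orientations $D$ of $G$. 2. For every strongly connected orientation $D$ of $G$ the equation $\Delta(f_D)=d^{\mathrm{out}}-d^{\mathrm{in}}$ has a solution $f_D:V\to\mathbb R$, unique up to an additive constant. Call $D$ well-balanced if $\langle f_D,\Delta(f_D)\rangle$ is minimal among all strongly connected orientations of $G$. Well-balanced orientations exist, and for every well-balanced $D$ $$\mathrm{Cov}(\Lambda)=\frac{\epsilon}{4}-\frac14\langle f_D,\Delta(f_D)\rangle .$$ 3. If $G$ is Eulerian (every vertex has even degree, a loop counting twice), then $\mathrm{Cov}(\Lambda)=\dfrac{|E|}{4}$.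 -/

import Mathlib

/-- A multigraph with vertex set `V` and edge set `E`; parallel edges and loops are allowed.
The two ends of an edge are listed in an arbitrary reference order, which serves only to name
the two oriented edges carried by that edge (two distinct ones also for a loop). -/
structure MultiG (V E : Type*) where
  /-- first end of an edge -/
  fstEnd : E → V
  /-- second end of an edge -/
  sndEnd : E → V

namespace MultiG

variable {V E : Type*}

/-- The set of oriented edges: each edge is replaced with two oriented edges,
`(e, true)` from `fstEnd e` to `sndEnd e`, and `(e, false)` in the opposite direction. -/
abbrev OEdge (E : Type*) := E × Bool

/-- The inverse of an oriented edge. -/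
def rev (a : OEdge E) : OEdge E := (a.1, !a.2)

/-- The tail of an oriented edge. -/
def tail (G : MultiG V E) (a : OEdge E) : V := if a.2 then G.fstEnd a.1 else G.sndEnd a.1

/-- The head of an oriented edge. -/
def head (G : MultiG V E) (a : OEdge E) : V := if a.2 then G.sndEnd a.1 else G.fstEnd a.1

/-- There is an oriented path from `u` to `v` that uses only oriented edges from `S`. -/
def Reach (G : MultiG V E) (S : Set (OEdge E)) (u v : V) : Prop :=
  Relation.ReflTransGen (fun x y => ∃ a ∈ S, G.tail a = x ∧ G.head a = y) u v

/-- The graph is connected. -/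
def Connected (G : MultiG V E) : Prop :=
  Nonempty V ∧ ∀ u v : V, G.Reach Set.univ u v

/-- An edge is a bridge if its two ends are not connected after the edge is deleted. -/
def IsBridge (G : MultiG V E) (e : E) : Prop :=
  ¬ G.Reach {a | a.1 ≠ e} (G.fstEnd e) (G.sndEnd e)

/-- The number of edges that are not bridges. -/
noncomputable def numNonBridge (G : MultiG V E) : ℕ := Nat.card {e : E // ¬ G.IsBridge e}

/-- `D` is a strongly connected orientation of the whole graph, which means: of the graph minus
the set of its bridges. It contains exactly one of the two oriented edges of each non-bridge edge,
no orientation of a bridge, and inside each connected component of the graph minus its bridges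
any vertex can be reached from any other along `D`. -/
structure IsStrongOrientation (G : MultiG V E) (D : Finset (OEdge E)) : Prop where
  not_bridge : ∀ a ∈ D, ¬ G.IsBridge a.1
  exactly_one : ∀ e : E, ¬ G.IsBridge e → Xor ((e, true) ∈ D) ((e, false) ∈ D)
  strong : ∀ u v : V, G.Reach {a | ¬ G.IsBridge a.1} u v → G.Reach (↑D) u v

section Flows

variable [Fintype V] [DecidableEq V] [Fintype E] [DecidableEq E]

/-- The real vector space of real-valued flows: antisymmetric functions on oriented edges
whose sum over the oriented edges leaving any vertex is zero. -/
def flowSpace (G : MultiG V E) : Submodule ℝ (OEdge E → ℝ) where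
  carrier := {x | (∀ a, x (rev a) = - x a) ∧
    ∀ v : V, ∑ a ∈ Finset.univ.filter (fun a => G.tail a = v), x a = 0}
  add_mem' := by
    rintro x y ⟨hx, hx'⟩ ⟨hy, hy'⟩
    refine ⟨fun a => ?_, fun v => ?_⟩
    · simp only [Pi.add_apply, hx a, hy a]; ring
    · simp only [Pi.add_apply, Finset.sum_add_distrib, hx' v, hy' v, add_zero]
  zero_mem' := ⟨fun a => by simp, fun v => by simp⟩
  smul_mem' := by
    rintro c x ⟨hx, hx'⟩
    refine ⟨fun a => ?_, fun v => ?_⟩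
    · simp only [Pi.smul_apply, smul_eq_mul, hx a]; ring
    · simp only [Pi.smul_apply, smul_eq_mul, ← Finset.mul_sum, hx' v, mul_zero]

/-- The lattice of integer flows: the flows all of whose values are integers. -/
def flowLattice (G : MultiG V E) : AddSubgroup (OEdge E → ℝ) where
  carrier := {x | x ∈ G.flowSpace ∧ ∀ a, ∃ n : ℤ, x a = n}
  add_mem' := by
    rintro x y ⟨hx, hx'⟩ ⟨hy, hy'⟩
    refine ⟨G.flowSpace.add_mem hx hy, fun a => ?_⟩
    obtain ⟨m, hm⟩ := hx' a
    obtain ⟨n, hn⟩ := hy' a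
    exact ⟨m + n, by simp [hm, hn]⟩
  zero_mem' := ⟨G.flowSpace.zero_mem, fun a => ⟨0, by simp⟩⟩
  neg_mem' := by
    rintro x ⟨hx, hx'⟩
    refine ⟨G.flowSpace.neg_mem hx, fun a => ?_⟩
    obtain ⟨m, hm⟩ := hx' a
    exact ⟨-m, by simp [hm]⟩

/-- The pairing of antisymmetric functions on oriented edges for which the edges, each taken with
one of its two orientations, are orthonormal; each edge contributes once. -/
def pairing (x y : OEdge E → ℝ) : ℝ := ∑ e : E, x (e, true) * y (e, true)

/-- The quadratic form `q` of the pairing. -/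
def quad (x : OEdge E → ℝ) : ℝ := pairing x x

/-- `r` is such that the closed `q`-balls `{x | q (x - m) ≤ r}` around the points `m` of the
lattice of integer flows cover the space of real flows. -/
def IsCoveringBound (G : MultiG V E) (r : ℝ) : Prop :=
  ∀ x ∈ G.flowSpace, ∃ m ∈ G.flowLattice, quad (x - m) ≤ r

/-- The covering number of the lattice of integer flows. -/
noncomputable def coveringNumber (G : MultiG V E) : ℝ := sInf {r : ℝ | G.IsCoveringBound r}

/-- A circuit (an orientation of a cycle), as a set of oriented edges: its oriented edges
`a 0, …, a k` are cyclically consecutive, with distinct vertices and distinct underlying edges. -/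
def IsCircuit (G : MultiG V E) (C : Finset (OEdge E)) : Prop :=
  ∃ (k : ℕ) (a : Fin (k + 1) → OEdge E),
    Function.Injective (fun i => G.tail (a i)) ∧
    Function.Injective (fun i => (a i).1) ∧
    (∀ i, G.head (a i) = G.tail (a (i + 1))) ∧
    C = Finset.univ.image a

/-- The flow `x^C` of a circuit `C`. -/
def circuitFlow (C : Finset (OEdge E)) (a : OEdge E) : ℝ :=
  if a ∈ C then 1 else if rev a ∈ C then -1 else 0

/-- `v` is the flow `v^D` of the orientation `D`: a real flow with `2⟨v, x^C⟩ = ℓ(C)` for every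
circuit `C` contained in `D`, where `ℓ(C)` is the number of edges of `C`. -/
def IsOrientationFlow (G : MultiG V E) (D : Finset (OEdge E)) (v : OEdge E → ℝ) : Prop :=
  v ∈ G.flowSpace ∧
    ∀ C : Finset (OEdge E), G.IsCircuit C → C ⊆ D → 2 * pairing v (circuitFlow C) = (C.card : ℝ)

/-- The out-degree of `y` in `D`. -/
def outDeg (G : MultiG V E) (D : Finset (OEdge E)) (y : V) : ℕ :=
  (D.filter (fun a => G.tail a = y)).card

/-- The in-degree of `y` in `D`. -/
def inDeg (G : MultiG V E) (D : Finset (OEdge E)) (y : V) : ℕ :=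
  (D.filter (fun a => G.head a = y)).card

/-- The graph Laplacian: `Δ f y` is the sum of `f y - f z` over all edges from `y` to a
neighbour `z`, with multiplicity. -/
def laplacian (G : MultiG V E) (f : V → ℝ) (y : V) : ℝ :=
  ∑ a ∈ Finset.univ.filter (fun a : OEdge E => G.tail a = y), (f y - f (G.head a))

/-- The Dirichlet energy `⟨f, Δ f⟩`, for the standard inner product on functions on vertices. -/
def energy (G : MultiG V E) (f : V → ℝ) : ℝ := ∑ y, f y * G.laplacian f y

/-- `f` solves the Laplacian equation `Δ f = d^out - d^in` of the orientation `D`. -/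
def IsPotential (G : MultiG V E) (D : Finset (OEdge E)) (f : V → ℝ) : Prop :=
  ∀ y, G.laplacian f y = (G.outDeg D y : ℝ) - (G.inDeg D y : ℝ)

/-- `D` is well-balanced: a strongly connected orientation for which `⟨f_D, Δ f_D⟩` is minimal
among all strongly connected orientations. -/
def IsWellBalanced (G : MultiG V E) (D : Finset (OEdge E)) : Prop :=
  G.IsStrongOrientation D ∧ ∃ f, G.IsPotential D f ∧
    ∀ D' f', G.IsStrongOrientation D' → G.IsPotential D' f' → G.energy f ≤ G.energy f'

/-- The graph is Eulerian: every vertex has even degree (a loop counts twice). -/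
def IsEulerian (G : MultiG V E) : Prop :=
  ∀ v, Even (Finset.univ.filter (fun a : OEdge E => G.tail a = v)).card

end Flows

end MultiG

/-!
In the edge space `ℝ^E` the flows form the orthogonal complement of the coboundaries; let `P` be
the orthogonal projection to them. The Voronoi cell of the lattice `Λ` of integer flows is `P`
applied to the unit cube centred at the origin. Indeed, if `y` in the cell is compared with the
flows `x^C`, then the weights `1/2 - y` have nonnegative sum along every circuit, so that distances
for these weights give a potential `f` with `y - grad f` in the cube; the converse holds because
`2 t n ≤ n ^ 2` for `|t| ≤ 1/2` and `n` an integer.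

Hence `Cov(Λ)` is the maximum of `‖P y‖ ^ 2` over the cube, which by convexity is attained at a
vertex, that is, at half the sign vector of an orientation. A maximal vertex orients the graph minus
its bridges strongly: otherwise a directed cut could be reversed without changing the projection,
and then flipping a single edge of the cut in the vertex or in its modification would increase the
norm. For a strongly connected orientation `D` the circuits in `D` separate flows, so `v^D` is the
projection of half the sign vector of `D`, and Pythagoras turns its norm into
`ε/4 - ⟨f_D, Δ f_D⟩/4`, since `grad f_D` is the other component of the sign vector.

In an Eulerian graph there is an integer flow all of whose values are odd. Half of it has distance
at least `1/2` from the integers in every coordinate, while `‖P y‖ ^ 2 ≤ ‖y‖ ^ 2 ≤ |E|/4` on the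
cube.
-/

namespace MultiG

variable {V E : Type*} {G : MultiG V E}

lemma rev_rev (a : OEdge E) : rev (rev a) = a := by simp [rev]

lemma tail_rev (G : MultiG V E) (a : OEdge E) : G.tail (rev a) = G.head a := by
  rcases a with ⟨e, _ | _⟩ <;> rfl

lemma head_rev (G : MultiG V E) (a : OEdge E) : G.head (rev a) = G.tail a := by
  rcases a with ⟨e, _ | _⟩ <;> rfl

lemma eq_or_eq_rev {a b : OEdge E} (h : a.1 = b.1) : a = b ∨ b = rev a := by
  rcases a with ⟨e, _ | _⟩ <;> rcases b with ⟨e', _ | _⟩ <;> simp_all [rev]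

section Reachability

variable {S T : Set (OEdge E)} {u v : V}

lemma reach_of_mem {a : OEdge E} (ha : a ∈ S) : G.Reach S (G.tail a) (G.head a) :=
  .single ⟨a, ha, rfl, rfl⟩

lemma Reach.mono (hST : S ⊆ T) (h : G.Reach S u v) : G.Reach T u v :=
  Relation.ReflTransGen.mono (fun _ _ ⟨a, ha, h⟩ => ⟨a, hST ha, h⟩) _ _ h

lemma Reach.symm (hS : ∀ a ∈ S, rev a ∈ S) (h : G.Reach S u v) : G.Reach S v u := by
  induction h with
  | refl => exact .refl
  | tail _ h ih =>
    obtain ⟨a, ha, rfl, rfl⟩ := h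
    exact .head ⟨rev a, hS a ha, G.tail_rev a, G.head_rev a⟩ ih

lemma Reach.apply_le {α : Type*} [Preorder α] {f : V → α}
    (hf : ∀ a ∈ S, f (G.head a) ≤ f (G.tail a)) (h : G.Reach S u v) : f v ≤ f u := by
  induction h with
  | refl => exact le_rfl
  | tail _ h ih =>
    obtain ⟨a, ha, rfl, rfl⟩ := h
    exact (hf a ha).trans ih

lemma Reach.apply_eq {α : Type*} {f : V → α}
    (hf : ∀ a ∈ S, f (G.tail a) = f (G.head a)) (h : G.Reach S u v) : f u = f v := by
  induction h with
  | refl => rfl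
  | tail _ h ih =>
    obtain ⟨a, ha, rfl, rfl⟩ := h
    exact ih.trans (hf a ha)

lemma exists_root (hS : ∀ u v, G.Reach S u v → G.Reach S v u) :
    ∃ root : V → V, (∀ v, G.Reach S (root v) v) ∧ ∀ u v, G.Reach S u v → root u = root v := by
  let component : Setoid V := ⟨G.Reach S, fun _ => .refl, fun h => hS _ _ h, .trans⟩
  exact ⟨fun v => (Quotient.mk component v).out, fun v => Quotient.mk_out (s := component) v,
    fun u v h => congrArg Quotient.out (Quotient.sound (s := component) h)⟩

end Reachability

section Walks

variable {S : Set (OEdge E)} {u v : V} {l l' : List (OEdge E)}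

/-- The list `l` of oriented edges is a walk from `u` to `v`. Unlike `Reach`, a walk records its
edges, so that it can be weighted and cut into circuits. -/
def IsWalk (G : MultiG V E) : V → List (OEdge E) → V → Prop
  | u, [], v => u = v
  | u, a :: l, v => G.tail a = u ∧ IsWalk G (G.head a) l v

lemma isWalk_append : G.IsWalk u (l ++ l') v ↔ ∃ w, G.IsWalk u l w ∧ G.IsWalk w l' v := by
  induction l generalizing u with
  | nil => simp [IsWalk]
  | cons a l ih => simp [IsWalk, ih, and_assoc]

lemma IsWalk.concat (h : G.IsWalk u l v) {a : OEdge E} (ha : G.tail a = v) :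
    G.IsWalk u (l ++ [a]) (G.head a) :=
  isWalk_append.2 ⟨v, h, ha, rfl⟩

lemma Reach.exists_isWalk (h : G.Reach S u v) : ∃ l, G.IsWalk u l v ∧ ∀ a ∈ l, a ∈ S := by
  induction h with
  | refl => exact ⟨[], rfl, by simp⟩
  | tail _ h ih =>
    obtain ⟨a, ha, rfl, rfl⟩ := h
    obtain ⟨l, hl, hS⟩ := ih
    exact ⟨l ++ [a], hl.concat rfl, by simpa [or_imp, forall_and, ha] using hS⟩

lemma IsWalk.cons_map_head (h : G.IsWalk u l v) : u :: l.map G.head = l.map G.tail ++ [v] := by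
  induction l generalizing u with
  | nil => simpa [IsWalk] using h
  | cons a l ih => simp [h.1, ih h.2]

lemma IsWalk.map_head_eq_rotate (h : G.IsWalk u l u) :
    l.map G.head = (l.map G.tail).rotate 1 := by
  cases l with
  | nil => rfl
  | cons a l => simpa [h.1] using h.cons_map_head

lemma injective_getElem_of_nodup_map {α β : Type*} {f : α → β} {l : List α}
    (h : (l.map f).Nodup) {n : ℕ} (hn : l.length = n) :
    Function.Injective fun i : Fin n => f (l[(i : ℕ)]'(hn ▸ i.2)) := by
  subst hn
  intro i j hij
  exact Fin.ext <| (h.getElem_inj_iff (hi := by simp) (hj := by simp)).1 <| by simpa using hij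

lemma IsWalk.isCircuit_toFinset [DecidableEq E] (h : G.IsWalk u l u) (hl : l ≠ [])
    (htail : (l.map G.tail).Nodup) (hedge : (l.map Prod.fst).Nodup) : G.IsCircuit l.toFinset := by
  obtain ⟨k, hk⟩ : ∃ k, l.length = k + 1 := Nat.exists_eq_succ_of_ne_zero (by simpa using hl)
  refine ⟨k, fun i => l[(i : ℕ)], injective_getElem_of_nodup_map htail hk,
    injective_getElem_of_nodup_map hedge hk, fun i => ?_, ?_⟩
  · have hrotate := List.getElem_of_eq h.map_head_eq_rotate (i := i) (by simp [hk, i.2])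
    simpa [List.getElem_rotate, hk, Fin.val_add] using hrotate
  · ext x
    simp only [List.mem_toFinset, List.mem_iff_getElem, Finset.mem_image, Finset.mem_univ,
      true_and, hk, Fin.exists_iff]

lemma exists_eq_append_of_not_nodup_map {α β : Type*} {f : α → β} {l : List α}
    (h : ¬ (l.map f).Nodup) :
    ∃ l₁ a l₂ b l₃, l = l₁ ++ (a :: l₂ ++ b :: l₃) ∧ f a = f b := by
  rw [List.Nodup, List.pairwise_map, List.pairwise_iff_forall_sublist] at h
  simp only [not_forall, not_not] at h
  obtain ⟨a, b, hsub, hab⟩ := h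
  obtain ⟨r₁, r₂, rfl, ha, hb⟩ := List.cons_sublist_iff.1 hsub
  obtain ⟨l₁, l₂, rfl⟩ := List.append_of_mem ha
  obtain ⟨l₂', l₃, rfl⟩ := List.append_of_mem (List.singleton_sublist.1 hb)
  exact ⟨l₁, a, l₂ ++ l₂', b, l₃, by simp, hab⟩

lemma IsWalk.exists_closed_subwalk (h : G.IsWalk u l v) (hl : ¬ (l.map G.tail).Nodup) :
    ∃ x l₁ l₂ l₃, l = l₁ ++ (l₂ ++ l₃) ∧ l₂ ≠ [] ∧ l₃ ≠ [] ∧ G.IsWalk x l₂ x ∧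
      G.IsWalk u (l₁ ++ l₃) v := by
  obtain ⟨l₁, a, l₂, b, l₃, rfl, hab⟩ := exists_eq_append_of_not_nodup_map hl
  obtain ⟨x, h₁, h₂⟩ := isWalk_append.1 h
  obtain ⟨y, h₂, h₃⟩ := isWalk_append.1 h₂
  obtain rfl : x = y := by rw [← h₂.1, hab, h₃.1]
  exact ⟨x, l₁, a :: l₂, b :: l₃, rfl, List.cons_ne_nil _ _, List.cons_ne_nil _ _, h₂,
    isWalk_append.2 ⟨x, h₁, h₃⟩⟩

lemma IsWalk.exists_backtracked_edge (h : G.IsWalk u l v) (htail : (l.map G.tail).Nodup)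
    (hedge : ¬ (l.map Prod.fst).Nodup) :
    ∃ a l₁ l₂ l₃, l = l₁ ++ (a :: l₂ ++ rev a :: l₃) ∧ G.IsWalk (G.head a) l₂ (G.head a) ∧
      G.IsWalk u (l₁ ++ l₃) v := by
  obtain ⟨l₁, a, l₂, b, l₃, rfl, hab⟩ := exists_eq_append_of_not_nodup_map hedge
  obtain rfl : b = rev a := (eq_or_eq_rev hab).resolve_left fun hab => by
    simp [hab, List.nodup_append] at htail
  obtain ⟨x, h₁, h₂⟩ := isWalk_append.1 h
  obtain ⟨y, ⟨rfl, h₂⟩, rfl, h₃⟩ := isWalk_append.1 h₂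
  rw [tail_rev] at h₂
  rw [head_rev] at h₃
  exact ⟨a, l₁, l₂, l₃, rfl, h₂, isWalk_append.2 ⟨_, h₁, h₃⟩⟩

lemma IsWalk.sum_nonneg [DecidableEq E] {w : OEdge E → ℝ}
    (hrev : ∀ a ∈ S, rev a ∈ S → 0 ≤ w a + w (rev a))
    (hcircuit : ∀ C : Finset (OEdge E), G.IsCircuit C → ↑C ⊆ S → 0 ≤ ∑ a ∈ C, w a)
    (h : G.IsWalk u l u) (hS : ∀ a ∈ l, a ∈ S) : 0 ≤ (l.map w).sum := by
  induction hn : l.length using Nat.strong_induction_on generalizing l u with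
  | _ n ih =>
  subst hn
  by_cases htail : (l.map G.tail).Nodup
  · by_cases hedge : (l.map Prod.fst).Nodup
    · rcases eq_or_ne l [] with rfl | hl
      · exact List.sum_nil.ge
      · rw [← List.sum_toFinset _ htail.of_map]
        exact hcircuit _ (h.isCircuit_toFinset hl htail hedge) (by simpa [Set.subset_def] using hS)
    · obtain ⟨a, l₁, l₂, l₃, rfl, h₂, h₁₃⟩ := h.exists_backtracked_edge htail hedge
      simp only [List.forall_mem_append, List.forall_mem_cons] at hS
      obtain ⟨hS₁, ⟨ha, hS₂⟩, hrev_a, hS₃⟩ := hS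
      have hpair := hrev a ha hrev_a
      have hinner := ih l₂.length (by simp; omega) h₂ hS₂ rfl
      have houter := ih (l₁ ++ l₃).length (by simp; omega) h₁₃
        (List.forall_mem_append.2 ⟨hS₁, hS₃⟩) rfl
      simp only [List.map_append, List.map_cons, List.sum_append, List.sum_cons] at houter ⊢
      linarith
  · obtain ⟨x, l₁, l₂, l₃, rfl, hl₂, hl₃, h₂, h₁₃⟩ := h.exists_closed_subwalk htail
    simp only [List.forall_mem_append] at hS
    obtain ⟨hS₁, hS₂, hS₃⟩ := hS
    have hlength₂ := List.length_pos_iff.2 hl₂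
    have hlength₃ := List.length_pos_iff.2 hl₃
    have hinner := ih l₂.length (by simp only [List.length_append]; omega) h₂ hS₂ rfl
    have houter := ih (l₁ ++ l₃).length (by simp only [List.length_append]; omega) h₁₃
      (List.forall_mem_append.2 ⟨hS₁, hS₃⟩) rfl
    simp only [List.map_append, List.sum_append] at houter ⊢
    linarith

/-- The weights of the walks in `S` from `u` to `v`; their infimum is the distance from `u` to
`v`. -/
def walkWeights (G : MultiG V E) (S : Set (OEdge E)) (w : OEdge E → ℝ) (u v : V) : Set ℝ :=
  {c | ∃ l, G.IsWalk u l v ∧ (∀ a ∈ l, a ∈ S) ∧ (l.map w).sum = c}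

lemma walkWeights_nonempty {w : OEdge E → ℝ} (h : G.Reach S u v) :
    (G.walkWeights S w u v).Nonempty :=
  have ⟨l, hl, hS⟩ := h.exists_isWalk
  ⟨_, l, hl, hS, rfl⟩

lemma add_mem_walkWeights {w : OEdge E → ℝ} {a : OEdge E} (ha : a ∈ S) {c : ℝ}
    (hc : c ∈ G.walkWeights S w u (G.tail a)) : c + w a ∈ G.walkWeights S w u (G.head a) := by
  obtain ⟨l, hl, hS, rfl⟩ := hc
  exact ⟨l ++ [a], hl.concat rfl, by simpa [or_imp, forall_and, ha] using hS, by simp⟩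

lemma bddBelow_walkWeights [DecidableEq E] {w : OEdge E → ℝ} (hvu : G.Reach S v u)
    (hrev : ∀ a ∈ S, rev a ∈ S → 0 ≤ w a + w (rev a))
    (hcircuit : ∀ C : Finset (OEdge E), G.IsCircuit C → ↑C ⊆ S → 0 ≤ ∑ a ∈ C, w a) :
    BddBelow (G.walkWeights S w u v) := by
  obtain ⟨l', hl', hS'⟩ := hvu.exists_isWalk
  refine ⟨-(l'.map w).sum, ?_⟩
  rintro _ ⟨l, hl, hS, rfl⟩
  have hclosed := (isWalk_append.2 ⟨_, hl, hl'⟩).sum_nonneg hrev hcircuit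
    fun a ha => (List.mem_append.1 ha).elim (hS a) (hS' a)
  rw [List.map_append, List.sum_append] at hclosed
  linarith

lemma exists_apply_head_le_add [DecidableEq E] {w : OEdge E → ℝ}
    (hsymm : ∀ u v, G.Reach S u v → G.Reach S v u)
    (hrev : ∀ a ∈ S, rev a ∈ S → 0 ≤ w a + w (rev a))
    (hcircuit : ∀ C : Finset (OEdge E), G.IsCircuit C → ↑C ⊆ S → 0 ≤ ∑ a ∈ C, w a) :
    ∃ f : V → ℝ, ∀ a ∈ S, f (G.head a) ≤ f (G.tail a) + w a := by
  obtain ⟨root, hroot, hconst⟩ := exists_root hsymm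
  refine ⟨fun v => sInf (G.walkWeights S w (root v) v), fun a ha => ?_⟩
  simp only [hconst _ _ (reach_of_mem ha)]
  rw [← sub_le_iff_le_add]
  have hreach : G.Reach S (root (G.head a)) (G.tail a) := hconst _ _ (reach_of_mem ha) ▸ hroot _
  refine le_csInf (walkWeights_nonempty hreach) fun c hc => sub_le_iff_le_add.2 ?_
  exact csInf_le (bddBelow_walkWeights (hsymm _ _ (hroot _)) hrev hcircuit)
    (add_mem_walkWeights ha hc)

lemma exists_eq_apply_tail_sub [DecidableEq E] {w : OEdge E → ℝ}
    (hsymm : ∀ u v, G.Reach S u v → G.Reach S v u)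
    (hrev : ∀ a ∈ S, rev a ∈ S → w a + w (rev a) = 0)
    (hcircuit : ∀ C : Finset (OEdge E), G.IsCircuit C → ↑C ⊆ S → ∑ a ∈ C, w a = 0) :
    ∃ f : V → ℝ, ∀ a ∈ S, w a = f (G.tail a) - f (G.head a) := by
  obtain ⟨f, hf⟩ := exists_apply_head_le_add hsymm (fun a ha ha' => (hrev a ha ha').ge)
    fun C hC hCS => (hcircuit C hC hCS).ge
  obtain ⟨g, hg⟩ := exists_apply_head_le_add (w := -w) hsymm
    (fun a ha ha' => by simp only [Pi.neg_apply]; linarith [hrev a ha ha'])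
    fun C hC hCS => by simp [hcircuit C hC hCS]
  refine ⟨-f, fun a ha => ?_⟩
  have hfg := (hsymm _ _ (reach_of_mem ha)).apply_le (f := f + g) fun b hb => by
    have := hf b hb
    have := hg b hb
    simp only [Pi.add_apply, Pi.neg_apply] at *
    linarith
  have := hf a ha
  have := hg a ha
  simp only [Pi.add_apply, Pi.neg_apply] at *
  linarith

end Walks

section Coordinates

/-- The antisymmetric function on oriented edges with value `y e` at `(e, true)`. It turns the
edge space, with its Euclidean norm, into the space of antisymmetric functions. -/
def ofCoord : EuclideanSpace ℝ E →ₗ[ℝ] (OEdge E → ℝ) where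
  toFun y a := if a.2 then y a.1 else -y a.1
  map_add' y z := by ext ⟨e, _ | _⟩ <;> simp [add_comm]
  map_smul' c y := by ext ⟨e, _ | _⟩ <;> simp

/-- The coordinates of a function on oriented edges: its values at the `(e, true)`. On
antisymmetric functions this is inverse to `ofCoord`. -/
def coord : (OEdge E → ℝ) →ₗ[ℝ] EuclideanSpace ℝ E where
  toFun x := WithLp.toLp 2 fun e => x (e, true)
  map_add' _ _ := rfl
  map_smul' _ _ := rfl

lemma coord_apply (x : OEdge E → ℝ) (e : E) : coord x e = x (e, true) := rfl

lemma ofCoord_true (y : EuclideanSpace ℝ E) (e : E) : ofCoord y (e, true) = y e := rfl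

lemma ofCoord_false (y : EuclideanSpace ℝ E) (e : E) : ofCoord y (e, false) = -y e := rfl

lemma ofCoord_rev (y : EuclideanSpace ℝ E) (a : OEdge E) : ofCoord y (rev a) = -ofCoord y a := by
  rcases a with ⟨e, _ | _⟩ <;> simp [rev, ofCoord]

lemma abs_ofCoord (y : EuclideanSpace ℝ E) (a : OEdge E) : |ofCoord y a| = |y a.1| := by
  rcases a with ⟨e, _ | _⟩ <;> simp [ofCoord]

lemma coord_ofCoord (y : EuclideanSpace ℝ E) : coord (ofCoord y) = y := rfl

lemma ofCoord_coord {x : OEdge E → ℝ} (hx : ∀ a, x (rev a) = -x a) : ofCoord (coord x) = x := by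
  ext ⟨e, _ | _⟩
  · exact (hx (e, true)).symm
  · rfl

lemma pairing_eq_inner [Fintype E] (x y : OEdge E → ℝ) :
    pairing x y = inner ℝ (coord x) (coord y) := by
  simp [pairing, PiLp.inner_apply, coord_apply, mul_comm]

lemma quad_eq_norm_sq [Fintype E] (x : OEdge E → ℝ) : quad x = ‖coord x‖ ^ 2 := by
  rw [quad, pairing_eq_inner, real_inner_self_eq_norm_sq]

/-- The signed indicator vector of a set `D` of oriented edges; it is used for orientations and,
as the coordinates of `x^C`, for circuits. -/
def signVec [DecidableEq E] (D : Finset (OEdge E)) : EuclideanSpace ℝ E :=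
  coord fun a => (if a ∈ D then 1 else 0) - if rev a ∈ D then 1 else 0

section SignVec

variable [DecidableEq E] {D : Finset (OEdge E)}

lemma ofCoord_signVec (D : Finset (OEdge E)) (a : OEdge E) :
    ofCoord (signVec D) a = (if a ∈ D then 1 else 0) - if rev a ∈ D then 1 else 0 := by
  rw [signVec, ofCoord_coord fun a => by simp [rev_rev]]

lemma ofCoord_signVec_of_mem (hD : ∀ a ∈ D, rev a ∉ D) {a : OEdge E} (ha : a ∈ D) :
    ofCoord (signVec D) a = 1 := by
  simp [ofCoord_signVec, ha, hD a ha]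

lemma coord_circuitFlow (hD : ∀ a ∈ D, rev a ∉ D) : coord (circuitFlow D) = signVec D := by
  ext e
  have := hD (e, true)
  simp only [coord_apply, circuitFlow, signVec]
  split_ifs <;> simp_all

lemma abs_signVec_le (D : Finset (OEdge E)) (e : E) : |signVec D e| ≤ 1 := by
  simp only [signVec, coord_apply]
  split_ifs <;> norm_num

lemma inner_signVec [Fintype E] (y : EuclideanSpace ℝ E) (D : Finset (OEdge E)) :
    inner ℝ y (signVec D) = ∑ a ∈ D, ofCoord y a := by
  rw [← Fintype.sum_ite_mem, Fintype.sum_prod_type]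
  simp only [PiLp.inner_apply]
  refine Finset.sum_congr rfl fun e _ => ?_
  by_cases h : (e, true) ∈ D <;> by_cases h' : (e, false) ∈ D <;>
    simp [signVec, coord_apply, rev, ofCoord_true, ofCoord_false, h, h']

lemma norm_signVec_sq [Fintype E] (hD : ∀ a ∈ D, rev a ∉ D) : ‖signVec D‖ ^ 2 = D.card := by
  rw [← real_inner_self_eq_norm_sq, inner_signVec,
    Finset.sum_congr rfl fun a ha => ofCoord_signVec_of_mem hD ha]
  simp

end SignVec

/-- The coboundary `f (tail) - f (head)` of a function on the vertices. -/
def grad (G : MultiG V E) : (V → ℝ) →ₗ[ℝ] EuclideanSpace ℝ E where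
  toFun f := coord fun a => f (G.tail a) - f (G.head a)
  map_add' f g := by
    rw [← map_add]
    exact congrArg coord (funext fun a => add_sub_add_comm _ _ _ _)
  map_smul' c f := by
    rw [RingHom.id_apply, ← map_smul]
    exact congrArg coord (funext fun a => (mul_sub _ _ _).symm)

lemma ofCoord_grad (f : V → ℝ) (a : OEdge E) :
    ofCoord (G.grad f) a = f (G.tail a) - f (G.head a) := by
  change ofCoord (coord fun b => f (G.tail b) - f (G.head b)) a = _
  rw [ofCoord_coord fun a => by simp [tail_rev, head_rev]]

lemma grad_eq_zero_iff {f : V → ℝ} :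
    G.grad f = 0 ↔ ∀ u v, G.Reach Set.univ u v → f u = f v := by
  refine ⟨fun h u v => Reach.apply_eq fun a _ => sub_eq_zero.1 ?_, fun h => ?_⟩
  · simp [← ofCoord_grad, h]
  · ext e
    exact sub_eq_zero.2 (h _ _ (reach_of_mem (Set.mem_univ (e, true))))

end Coordinates

section Flows

variable [Fintype E]

lemma inner_grad (f : V → ℝ) (y : EuclideanSpace ℝ E) :
    inner ℝ (G.grad f) y = ∑ a, f (G.tail a) * ofCoord y a := by
  rw [Fintype.sum_prod_type, PiLp.inner_apply]
  refine Finset.sum_congr rfl fun e _ => ?_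
  rw [Fintype.sum_bool, ofCoord_true, ofCoord_false]
  change y e * (f (G.fstEnd e) - f (G.sndEnd e)) = f (G.fstEnd e) * y e + f (G.sndEnd e) * -y e
  ring

/-- The flows in coordinates: the cycle space, defined as the orthogonal complement of the
coboundaries. -/
noncomputable def flows (G : MultiG V E) : Submodule ℝ (EuclideanSpace ℝ E) :=
  (LinearMap.range G.grad)ᗮ

/-- The orthogonal projection to the cycle space. -/
noncomputable abbrev proj (G : MultiG V E) : EuclideanSpace ℝ E →L[ℝ] EuclideanSpace ℝ E :=
  G.flows.starProjection

lemma mem_flows_iff_inner {y : EuclideanSpace ℝ E} :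
    y ∈ G.flows ↔ ∀ f, inner ℝ (G.grad f) y = 0 := by
  simp [flows, Submodule.mem_orthogonal]

lemma mem_flows_iff [DecidableEq V] {y : EuclideanSpace ℝ E} :
    y ∈ G.flows ↔ ∀ v, ∑ a with G.tail a = v, ofCoord y a = 0 := by
  simp only [mem_flows_iff_inner, inner_grad]
  refine ⟨fun h v => ?_, fun h f => ?_⟩
  · simpa [Pi.single_apply, ← Finset.sum_filter] using h (Pi.single v 1)
  · rw [← Finset.sum_fiberwise_of_maps_to
      fun a _ => Finset.mem_image_of_mem G.tail (Finset.mem_univ a)]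
    refine Finset.sum_eq_zero fun v _ => ?_
    rw [← mul_zero (f v), ← h v, Finset.mul_sum]
    exact Finset.sum_congr rfl fun a ha => by rw [(Finset.mem_filter.1 ha).2]

lemma ofCoord_mem_flowSpace [DecidableEq V] {y : EuclideanSpace ℝ E} :
    ofCoord y ∈ G.flowSpace ↔ y ∈ G.flows := by
  rw [mem_flows_iff]
  exact and_iff_right (ofCoord_rev y)

lemma coord_mem_flows [DecidableEq V] {x : OEdge E → ℝ} (hx : x ∈ G.flowSpace) :
    coord x ∈ G.flows := by
  rwa [← ofCoord_mem_flowSpace, ofCoord_coord hx.1]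

lemma orthogonal_flows : G.flowsᗮ = LinearMap.range G.grad :=
  Submodule.orthogonal_orthogonal _

lemma proj_grad (f : V → ℝ) : G.proj (G.grad f) = 0 := by
  rw [Submodule.starProjection_apply_eq_zero_iff, orthogonal_flows]
  exact ⟨f, rfl⟩

lemma exists_grad_eq_sub_proj (y : EuclideanSpace ℝ E) : ∃ f, G.grad f = y - G.proj y := by
  have h := G.flows.sub_starProjection_mem_orthogonal y
  rwa [orthogonal_flows] at h

lemma sub_grad_mem_flows_iff {y : EuclideanSpace ℝ E} {f : V → ℝ} :
    y - G.grad f ∈ G.flows ↔ G.grad f = y - G.proj y := by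
  rw [← Submodule.starProjection_eq_self_iff, map_sub, proj_grad, sub_zero, eq_sub_iff_add_eq,
    eq_sub_iff_add_eq, add_comm]

end Flows

section Laplacian

variable [DecidableEq V] [Fintype E] {f : V → ℝ}

lemma laplacian_eq_sum (f : V → ℝ) (v : V) :
    G.laplacian f v = ∑ a with G.tail a = v, ofCoord (G.grad f) a :=
  Finset.sum_congr rfl fun a ha => by rw [ofCoord_grad, (Finset.mem_filter.1 ha).2]

lemma energy_eq_norm_sq [Fintype V] (f : V → ℝ) : G.energy f = ‖G.grad f‖ ^ 2 := by
  rw [← real_inner_self_eq_norm_sq, inner_grad, energy, ← Finset.sum_fiberwise _ G.tail]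
  refine Finset.sum_congr rfl fun v _ => ?_
  rw [laplacian_eq_sum, Finset.mul_sum]
  exact Finset.sum_congr rfl fun a ha => by rw [(Finset.mem_filter.1 ha).2]

variable {D : Finset (OEdge E)}

lemma outDeg_sub_inDeg [DecidableEq E] (D : Finset (OEdge E)) (v : V) :
    (G.outDeg D v : ℝ) - G.inDeg D v = ∑ a with G.tail a = v, ofCoord (signVec D) a := by
  have hout : (G.outDeg D v : ℝ) = ∑ a with G.tail a = v, if a ∈ D then 1 else 0 := by
    rw [Finset.sum_boole, outDeg, Finset.filter_mem_eq_inter]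
    congr 2
    ext a
    simp [and_comm]
  have hin : (G.inDeg D v : ℝ) = ∑ a with G.tail a = v, if rev a ∈ D then 1 else 0 := by
    rw [Finset.sum_boole, inDeg]
    congr 1
    exact Finset.card_nbij' rev rev
      (fun a ha => by simpa [tail_rev, rev_rev, and_comm] using ha)
      (fun a ha => by simpa [head_rev, and_comm] using ha)
      (fun a _ => rev_rev a) (fun a _ => rev_rev a)
  rw [hout, hin, ← Finset.sum_sub_distrib]
  simp only [ofCoord_signVec]

lemma isPotential_iff [DecidableEq E] :
    G.IsPotential D f ↔ G.grad f = signVec D - G.proj (signVec D) := by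
  rw [← sub_grad_mem_flows_iff, mem_flows_iff]
  refine forall_congr' fun v => ?_
  simp only [laplacian_eq_sum, outDeg_sub_inDeg, map_sub, Pi.sub_apply, Finset.sum_sub_distrib]
  rw [sub_eq_zero, eq_comm]

lemma exists_isPotential (G : MultiG V E) (D : Finset (OEdge E)) : ∃ f, G.IsPotential D f := by
  classical
  simpa only [isPotential_iff] using exists_grad_eq_sub_proj (signVec D)

lemma IsPotential.sub_eq_sub {f' : V → ℝ} (hf : G.IsPotential D f) (hf' : G.IsPotential D f')
    {u v : V} (h : G.Reach Set.univ u v) : f' u - f u = f' v - f v := by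
  classical
  suffices hzero : G.grad (f' - f) = 0 from grad_eq_zero_iff.1 hzero u v h
  rw [map_sub, isPotential_iff.1 hf, isPotential_iff.1 hf', sub_self]

lemma norm_proj_half_signVec_sq [Fintype V] [DecidableEq E] (hD : ∀ a ∈ D, rev a ∉ D)
    (hf : G.IsPotential D f) :
    ‖G.proj ((1 / 2 : ℝ) • signVec D)‖ ^ 2 = (D.card : ℝ) / 4 - G.energy f / 4 := by
  have hpyth := Submodule.norm_sq_eq_add_norm_sq_starProjection (signVec D) G.flows
  rw [Submodule.starProjection_orthogonal_val, ← isPotential_iff.1 hf, norm_signVec_sq hD,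
    ← energy_eq_norm_sq] at hpyth
  rw [map_smul, norm_smul, mul_pow, Real.norm_eq_abs, sq_abs]
  linarith

end Laplacian

section Bridges

variable {S : Set (OEdge E)} {u v : V} {e : E}

/-- The indicator function of the vertices that can be reached from `u` along `S`: a cut whose
coboundary has one sign on `S`. -/
noncomputable def reachIndicator (G : MultiG V E) (S : Set (OEdge E)) (u : V) : V → ℝ :=
  Set.indicator {v | G.Reach S u v} 1

lemma reachIndicator_of_reach (h : G.Reach S u v) : G.reachIndicator S u v = 1 :=
  Set.indicator_of_mem (s := {v | G.Reach S u v}) h 1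

lemma reachIndicator_of_not_reach (h : ¬ G.Reach S u v) : G.reachIndicator S u v = 0 :=
  Set.indicator_of_notMem (s := {v | G.Reach S u v}) h 1

lemma ofCoord_grad_reachIndicator {a : OEdge E} (ha : a ∈ S) :
    ofCoord (G.grad (G.reachIndicator S u)) a = 0 ∨
      ofCoord (G.grad (G.reachIndicator S u)) a = -1 := by
  rw [ofCoord_grad]
  by_cases htail : G.Reach S u (G.tail a)
  · have hhead := htail.trans (reach_of_mem ha)
    simp [reachIndicator_of_reach htail, reachIndicator_of_reach hhead]
  · by_cases hhead : G.Reach S u (G.head a) <;>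
      simp [reachIndicator_of_reach, reachIndicator_of_not_reach, htail, hhead]

lemma grad_reachIndicator_eq_zero (htrue : (e, true) ∈ S) (hfalse : (e, false) ∈ S) :
    G.grad (G.reachIndicator S u) e = 0 := by
  have h := ofCoord_grad_reachIndicator (G := G) (u := u) htrue
  have h' := ofCoord_grad_reachIndicator (G := G) (u := u) hfalse
  rw [ofCoord_true] at h
  rw [ofCoord_false] at h'
  rcases h with h | h <;> rcases h' with h' | h' <;> linarith

variable [Fintype E]

lemma proj_single_eq_zero_iff [DecidableEq E] :
    G.proj (EuclideanSpace.single e 1) = 0 ↔ G.IsBridge e := by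
  refine ⟨fun h hreach => ?_, fun h => ?_⟩
  · obtain ⟨f, hf⟩ := exists_grad_eq_sub_proj (G := G) (EuclideanSpace.single e 1)
    rw [h, sub_zero] at hf
    have hconst : f (G.fstEnd e) = f (G.sndEnd e) := Reach.apply_eq (fun a ha => by
      rw [← sub_eq_zero, ← ofCoord_grad, hf, ← abs_eq_zero, abs_ofCoord]
      simpa using ha) hreach
    have hone : f (G.fstEnd e) - f (G.sndEnd e) = 1 :=
      (congrArg (fun y : EuclideanSpace ℝ E => y e) hf).trans (by simp)
    simp [hconst] at hone
  · suffices hcut : G.grad (G.reachIndicator {a | a.1 ≠ e} (G.fstEnd e)) =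
        EuclideanSpace.single e 1 by rw [← hcut, proj_grad]
    ext e'
    rcases eq_or_ne e' e with rfl | he
    · rw [← ofCoord_true, ofCoord_grad]
      simp [tail, head, reachIndicator_of_reach .refl, reachIndicator_of_not_reach h]
    · rw [grad_reachIndicator_eq_zero he he]
      simp [he]

lemma proj_congr {y z : EuclideanSpace ℝ E} (h : ∀ e, ¬ G.IsBridge e → y e = z e) :
    G.proj y = G.proj z := by
  classical
  rw [← sub_eq_zero, ← map_sub, ← (EuclideanSpace.basisFun E ℝ).sum_repr (y - z), map_sum]
  refine Finset.sum_eq_zero fun e _ => ?_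
  by_cases he : G.IsBridge e
  · simp [proj_single_eq_zero_iff.2 he]
  · simp [h e he]

end Bridges

section Circuits

variable [DecidableEq E] {C : Finset (OEdge E)}

lemma IsCircuit.rev_notMem (hC : G.IsCircuit C) : ∀ a ∈ C, rev a ∉ C := by
  obtain ⟨k, a, -, hedge, -, rfl⟩ := hC
  simp only [Finset.mem_image, Finset.mem_univ, true_and, not_exists, forall_exists_index,
    forall_apply_eq_imp_iff]
  intro i j hij
  obtain rfl : j = i := hedge (congrArg Prod.fst hij :)
  simpa [rev] using congrArg Prod.snd hij

lemma IsCircuit.sum_apply_tail {M : Type*} [AddCommMonoid M] (hC : G.IsCircuit C) (f : V → M) :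
    ∑ a ∈ C, f (G.tail a) = ∑ a ∈ C, f (G.head a) := by
  obtain ⟨k, a, htail, -, hnext, rfl⟩ := hC
  have hinj : Function.Injective a := Function.Injective.of_comp (f := G.tail) htail
  rw [Finset.sum_image hinj.injOn, Finset.sum_image hinj.injOn]
  simp only [hnext]
  exact (Equiv.sum_comp (Equiv.addRight (1 : Fin (k + 1))) fun i => f (G.tail (a i))).symm

variable [Fintype E]

lemma IsCircuit.signVec_mem_flows (hC : G.IsCircuit C) : signVec C ∈ G.flows := by
  refine mem_flows_iff_inner.2 fun f => ?_
  simp only [inner_signVec, ofCoord_grad, Finset.sum_sub_distrib, hC.sum_apply_tail, sub_self]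

lemma IsCircuit.sum_ofCoord_proj (hC : G.IsCircuit C) (y : EuclideanSpace ℝ E) :
    ∑ a ∈ C, ofCoord (G.proj y) a = ∑ a ∈ C, ofCoord y a := by
  rw [← inner_signVec, ← inner_signVec, Submodule.inner_starProjection_left_eq_right,
    Submodule.starProjection_eq_self_iff.2 hC.signVec_mem_flows]

lemma IsCircuit.pairing_circuitFlow (hC : G.IsCircuit C) (x : OEdge E → ℝ) :
    pairing x (circuitFlow C) = ∑ a ∈ C, ofCoord (coord x) a := by
  rw [pairing_eq_inner, coord_circuitFlow hC.rev_notMem, inner_signVec]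

end Circuits

section StrongOrientations

variable {D : Finset (OEdge E)}

namespace IsStrongOrientation

lemma rev_notMem (hD : G.IsStrongOrientation D) : ∀ a ∈ D, rev a ∉ D := by
  rintro ⟨e, _ | _⟩ ha hrev
  · exact (hD.exactly_one e (hD.not_bridge _ ha)).elim (fun h => h.2 ha) fun h => h.2 hrev
  · exact (hD.exactly_one e (hD.not_bridge _ ha)).elim (fun h => h.2 hrev) fun h => h.2 ha

lemma exists_mem (hD : G.IsStrongOrientation D) {e : E} (he : ¬ G.IsBridge e) :
    ∃ a ∈ D, a.1 = e :=
  (hD.exactly_one e he).elim (fun h => ⟨_, h.1, rfl⟩) fun h => ⟨_, h.1, rfl⟩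

lemma reach_symm (hD : G.IsStrongOrientation D) {u v : V} (h : G.Reach D u v) : G.Reach D v u :=
  hD.strong v u ((h.mono hD.not_bridge).symm fun _ ha => ha)

lemma card_eq_numNonBridge (hD : G.IsStrongOrientation D) : D.card = G.numNonBridge := by
  let edge (a : D) : {e : E // ¬ G.IsBridge e} := ⟨a.1.1, hD.not_bridge _ a.2⟩
  have hedge : Function.Bijective edge := by
    refine ⟨fun a b hab => Subtype.ext ?_, fun ⟨e, he⟩ => ?_⟩
    · rcases eq_or_eq_rev (congrArg Subtype.val hab) with h | h
      · exact h
      · exact absurd (h ▸ b.2) (hD.rev_notMem _ a.2)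
    · obtain ⟨a, ha, rfl⟩ := hD.exists_mem he
      exact ⟨⟨a, ha⟩, rfl⟩
  rw [numNonBridge, ← Nat.card_eq_of_bijective edge hedge, Nat.card_eq_fintype_card,
    Fintype.card_coe]

variable [Fintype E]

lemma proj_congr_of_mem (hD : G.IsStrongOrientation D) {y z : EuclideanSpace ℝ E}
    (h : ∀ a ∈ D, ofCoord y a = ofCoord z a) : G.proj y = G.proj z := by
  refine proj_congr fun e he => ?_
  obtain ⟨⟨_, _ | _⟩, ha, rfl⟩ := hD.exists_mem he
  · exact neg_injective (h _ ha)
  · exact h _ ha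

variable [DecidableEq E]

lemma eq_of_sum_circuit_eq (hD : G.IsStrongOrientation D) {y z : EuclideanSpace ℝ E}
    (hy : y ∈ G.flows) (hz : z ∈ G.flows)
    (h : ∀ C, G.IsCircuit C → C ⊆ D → ∑ a ∈ C, ofCoord y a = ∑ a ∈ C, ofCoord z a) : y = z := by
  obtain ⟨f, hf⟩ := exists_eq_apply_tail_sub (S := D) (w := ofCoord (y - z))
    (fun _ _ => hD.reach_symm) (fun a _ _ => by rw [ofCoord_rev, add_neg_cancel])
    fun C hC hCD => by simp [h C hC (by exact_mod_cast hCD)]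
  have hgrad : G.proj (y - z) = G.proj (G.grad f) :=
    hD.proj_congr_of_mem fun a ha => by rw [hf a ha, ofCoord_grad]
  rwa [proj_grad, Submodule.starProjection_eq_self_iff.2 (sub_mem hy hz), sub_eq_zero] at hgrad

lemma isOrientationFlow_iff [DecidableEq V] (hD : G.IsStrongOrientation D) {x : OEdge E → ℝ} :
    G.IsOrientationFlow D x ↔ x = ofCoord (G.proj ((1 / 2 : ℝ) • signVec D)) := by
  have hsum (C) (hC : G.IsCircuit C) (hCD : C ⊆ D) :
      2 * ∑ a ∈ C, ofCoord (G.proj ((1 / 2 : ℝ) • signVec D)) a = C.card := by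
    rw [hC.sum_ofCoord_proj, map_smul, Finset.sum_congr rfl fun a ha => by
      rw [Pi.smul_apply, ofCoord_signVec_of_mem hD.rev_notMem (hCD ha)],
      Finset.sum_const, nsmul_eq_mul, smul_eq_mul]
    ring
  refine ⟨fun ⟨hx, hcircuit⟩ => ?_, ?_⟩
  · rw [← hD.eq_of_sum_circuit_eq (coord_mem_flows hx) (Submodule.starProjection_apply_mem _ _)
      fun C hC hCD => ?_, ofCoord_coord hx.1]
    rw [← mul_right_inj' (two_ne_zero' ℝ), hsum C hC hCD, ← hC.pairing_circuitFlow,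
      hcircuit C hC hCD]
  · rintro rfl
    refine ⟨ofCoord_mem_flowSpace.2 (Submodule.starProjection_apply_mem _ _),
      fun C hC hCD => ?_⟩
    rw [hC.pairing_circuitFlow, coord_ofCoord, hsum C hC hCD]

lemma norm_proj_half_signVec_sq [DecidableEq V] [Fintype V] (hD : G.IsStrongOrientation D)
    {f : V → ℝ} (hf : G.IsPotential D f) :
    ‖G.proj ((1 / 2 : ℝ) • signVec D)‖ ^ 2 = (G.numNonBridge : ℝ) / 4 - G.energy f / 4 := by
  rw [MultiG.norm_proj_half_signVec_sq hD.rev_notMem hf, hD.card_eq_numNonBridge]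

end IsStrongOrientation

end StrongOrientations

section Lattice

/-- The vectors of the edge space with integer coordinates. -/
def intVectors (E : Type*) : AddSubgroup (EuclideanSpace ℝ E) where
  carrier := {y | ∀ e, y e ∈ (Int.castAddHom ℝ).range}
  add_mem' hy hz e := add_mem (hy e) (hz e)
  zero_mem' _ := zero_mem _
  neg_mem' hy e := neg_mem (hy e)

lemma isClosed_intVectors : IsClosed (intVectors E : Set (EuclideanSpace ℝ E)) := by
  have hint : IsClosed ((Int.castAddHom ℝ).range : Set ℝ) :=
    Int.isClosedEmbedding_coe_real.isClosed_range
  simp only [intVectors, AddSubgroup.coe_set_mk, Set.ofPred_forall]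
  exact isClosed_iInter fun e => hint.preimage (by fun_prop)

lemma signVec_mem_intVectors [DecidableEq E] (D : Finset (OEdge E)) :
    signVec D ∈ intVectors E := fun e => by
  refine ⟨(if (e, true) ∈ D then 1 else 0) - if rev (e, true) ∈ D then 1 else 0, ?_⟩
  simp [signVec, coord_apply]

variable [Fintype E]

/-- The lattice `Λ` of integer flows, in coordinates. -/
noncomputable def intFlows (G : MultiG V E) : AddSubgroup (EuclideanSpace ℝ E) :=
  G.flows.toAddSubgroup ⊓ intVectors E

lemma IsCircuit.signVec_mem_intFlows [DecidableEq E] {C : Finset (OEdge E)}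
    (hC : G.IsCircuit C) : signVec C ∈ G.intFlows :=
  ⟨hC.signVec_mem_flows, signVec_mem_intVectors C⟩

lemma isClosed_intFlows (G : MultiG V E) : IsClosed (G.intFlows : Set (EuclideanSpace ℝ E)) :=
  G.flows.closed_of_finiteDimensional.inter isClosed_intVectors

lemma ofCoord_mem_flowLattice [DecidableEq V] {y : EuclideanSpace ℝ E} :
    ofCoord y ∈ G.flowLattice ↔ y ∈ G.intFlows := by
  refine and_congr ofCoord_mem_flowSpace ⟨fun h e => ?_, ?_⟩
  · obtain ⟨n, hn⟩ := h (e, true)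
    exact ⟨n, hn.symm⟩
  · rintro h ⟨e, _ | _⟩ <;> obtain ⟨n, hn⟩ := h e
    · exact ⟨-n, by simp [ofCoord_false, ← hn]⟩
    · exact ⟨n, hn.symm⟩

lemma coord_mem_intFlows [DecidableEq V] {x : OEdge E → ℝ} (hx : x ∈ G.flowLattice) :
    coord x ∈ G.intFlows := by
  rwa [← ofCoord_mem_flowLattice, ofCoord_coord hx.1.1]

lemma isCoveringBound_iff_exists [DecidableEq V] {r : ℝ} :
    G.IsCoveringBound r ↔ ∀ y ∈ G.flows, ∃ m ∈ G.intFlows, ‖y - m‖ ^ 2 ≤ r := by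
  refine ⟨fun h y hy => ?_, fun h x hx => ?_⟩
  · obtain ⟨m, hm, hle⟩ := h _ (ofCoord_mem_flowSpace.2 hy)
    exact ⟨coord m, coord_mem_intFlows hm, by rwa [quad_eq_norm_sq, map_sub, coord_ofCoord] at hle⟩
  · obtain ⟨m, hm, hle⟩ := h _ (coord_mem_flows hx)
    exact ⟨ofCoord m, ofCoord_mem_flowLattice.2 hm,
      by rwa [quad_eq_norm_sq, map_sub, coord_ofCoord]⟩

/-- The Voronoi cell of `Λ` around the origin. -/
def voronoiCell (G : MultiG V E) : Set (EuclideanSpace ℝ E) :=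
  {y | y ∈ G.flows ∧ ∀ m ∈ G.intFlows, ‖y‖ ≤ ‖y - m‖}

lemma exists_sub_mem_voronoiCell {y : EuclideanSpace ℝ E} (hy : y ∈ G.flows) :
    ∃ m ∈ G.intFlows, y - m ∈ G.voronoiCell := by
  obtain ⟨m, hm, hdist⟩ := G.isClosed_intFlows.exists_infDist_eq_dist ⟨0, zero_mem _⟩ y
  refine ⟨m, hm, sub_mem hy hm.1, fun m' hm' => ?_⟩
  rw [← dist_eq_norm, ← hdist, sub_sub, ← dist_eq_norm]
  exact Metric.infDist_le_dist_of_mem (add_mem hm hm')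

lemma isCoveringBound_iff_voronoiCell [DecidableEq V] {r : ℝ} :
    G.IsCoveringBound r ↔ ∀ y ∈ G.voronoiCell, ‖y‖ ^ 2 ≤ r := by
  rw [isCoveringBound_iff_exists]
  refine ⟨fun h y ⟨hy, hnear⟩ => ?_, fun h y hy => ?_⟩
  · obtain ⟨m, hm, hle⟩ := h y hy
    exact (by gcongr; exact hnear m hm : ‖y‖ ^ 2 ≤ ‖y - m‖ ^ 2).trans hle
  · obtain ⟨m, hm, hcell⟩ := exists_sub_mem_voronoiCell hy
    exact ⟨m, hm, h _ hcell⟩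

lemma norm_le_norm_sub_iff {F : Type*} [NormedAddCommGroup F] [InnerProductSpace ℝ F] {x y : F} :
    ‖x‖ ≤ ‖x - y‖ ↔ 2 * inner ℝ x y ≤ ‖y‖ ^ 2 := by
  rw [← sq_le_sq₀ (norm_nonneg _) (norm_nonneg _), norm_sub_sq_real]
  constructor <;> intro h <;> linarith

end Lattice

section Cube

/-- The unit cube of the edge space, centred at the origin. -/
def unitCube (E : Type*) : Set (EuclideanSpace ℝ E) := {y | ∀ e, |y e| ≤ 1 / 2}

lemma mem_unitCube_iff {y : EuclideanSpace ℝ E} :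
    y ∈ unitCube E ↔ ∀ a, ofCoord y a ≤ 1 / 2 := by
  simp only [unitCube, Set.mem_ofPred_eq, abs_le', Prod.forall, Bool.forall_bool, ofCoord_true,
    ofCoord_false, and_comm]

lemma half_signVec_mem_unitCube [DecidableEq E] (D : Finset (OEdge E)) :
    (1 / 2 : ℝ) • signVec D ∈ unitCube E := fun e => by
  rw [PiLp.smul_apply, smul_eq_mul, abs_mul, abs_of_pos one_half_pos]
  linarith [abs_signVec_le D e]

lemma sub_two_mul_single_mem_unitCube [DecidableEq E] {y : EuclideanSpace ℝ E}
    (hy : y ∈ unitCube E) (e : E) :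
    y - (2 * y e) • EuclideanSpace.single e 1 ∈ unitCube E := fun e' => by
  rcases eq_or_ne e' e with rfl | he
  · rw [PiLp.sub_apply, PiLp.smul_apply, PiLp.single_apply, if_pos rfl, smul_eq_mul, mul_one,
      two_mul, sub_add_cancel_left, abs_neg]
    exact hy e'
  · simpa [he] using hy e'

lemma unitCube_subset_convexHull [Finite E] :
    unitCube E ⊆ convexHull ℝ {s : EuclideanSpace ℝ E | ∀ e, |s e| = 1 / 2} := by
  intro y hy
  have hbox : y.ofLp ∈ convexHull ℝ (Set.univ.pi fun _ : E => ({-1 / 2, 1 / 2} : Set ℝ)) := by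
    simp only [convexHull_pi, convexHull_pair, Set.mem_univ_pi]
    intro e
    rw [segment_eq_Icc (by norm_num), neg_div]
    exact abs_le.1 (hy e)
  have himage := Set.mem_image_of_mem (WithLp.linearEquiv 2 ℝ (E → ℝ)).symm.toLinearMap hbox
  rw [LinearMap.image_convexHull] at himage
  refine convexHull_mono ?_ himage
  rintro _ ⟨s, hs, rfl⟩ e
  change |s e| = 1 / 2
  rcases hs e trivial with h | h <;> rw [h] <;> norm_num [abs_div]

lemma exists_vertex_forall_le [Finite E] {φ : EuclideanSpace ℝ E → ℝ} (hφ : ConvexOn ℝ Set.univ φ) :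
    ∃ s : EuclideanSpace ℝ E, (∀ e, |s e| = 1 / 2) ∧ ∀ y ∈ unitCube E, φ y ≤ φ s := by
  have hfinite : {s : EuclideanSpace ℝ E | ∀ e, |s e| = 1 / 2}.Finite := by
    refine Set.Finite.subset (Set.Finite.image (WithLp.toLp 2)
      (Set.Finite.pi' fun _ : E => Set.toFinite ({1 / 2, -(1 / 2)} : Set ℝ))) fun s hs => ?_
    exact ⟨s.ofLp, fun e => eq_or_eq_neg_of_abs_eq (hs e), rfl⟩
  obtain ⟨s, hs, hmax⟩ := Set.exists_max_image _ φ hfinite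
    ⟨WithLp.toLp 2 fun _ => 1 / 2, fun _ => abs_of_pos one_half_pos⟩
  refine ⟨s, hs, fun y hy => ?_⟩
  obtain ⟨t, ht, hle⟩ := (hφ.subset (Set.subset_univ _) (convex_convexHull ℝ _)
    ).exists_ge_of_mem_convexHull (subset_convexHull ℝ _) (unitCube_subset_convexHull hy)
  exact hle.trans (hmax t ht)

variable [Fintype E]

lemma norm_sq_le_of_mem_unitCube {y : EuclideanSpace ℝ E} (hy : y ∈ unitCube E) :
    ‖y‖ ^ 2 ≤ (Fintype.card E : ℝ) / 4 := by
  have hsum : ∑ e, ‖y e‖ ^ 2 ≤ ∑ _e : E, (1 / 2 : ℝ) ^ 2 := by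
    gcongr with e
    exact hy e
  rw [EuclideanSpace.norm_sq_eq]
  rw [Finset.sum_const, Finset.card_univ, nsmul_eq_mul] at hsum
  linarith

lemma two_mul_inner_le_norm_sq {y m : EuclideanSpace ℝ E} (hy : y ∈ unitCube E)
    (hm : m ∈ intVectors E) : 2 * inner ℝ y m ≤ ‖m‖ ^ 2 := by
  rw [EuclideanSpace.norm_sq_eq, PiLp.inner_apply, Finset.mul_sum]
  refine Finset.sum_le_sum fun e _ => ?_
  obtain ⟨n, hn⟩ := hm e
  have hsq : |(n : ℝ)| ≤ (n : ℝ) ^ 2 :=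
    mod_cast (Int.abs_eq_natAbs n).trans_le (Int.natAbs_le_self_sq n)
  calc 2 * inner ℝ (y e) (m e) = 2 * (m e * y e) := rfl
    _ ≤ 2 * (|m e| * |y e|) := by rw [← abs_mul]; gcongr; exact le_abs_self _
    _ ≤ 2 * (|m e| * (1 / 2)) := by gcongr; exact hy e
    _ = |m e| := by ring
    _ ≤ ‖m e‖ ^ 2 := by
      rw [Real.norm_eq_abs, sq_abs, ← hn]
      exact hsq

lemma voronoiCell_subset_proj_image_unitCube : G.voronoiCell ⊆ G.proj '' unitCube E := by
  classical
  rintro y ⟨hy, hnear⟩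
  have hcircuit (C) (hC : G.IsCircuit C) : 0 ≤ ∑ a ∈ C, (1 / 2 - ofCoord y a) := by
    have := norm_le_norm_sub_iff.1 (hnear _ hC.signVec_mem_intFlows)
    rw [inner_signVec, norm_signVec_sq hC.rev_notMem] at this
    rw [Finset.sum_sub_distrib, Finset.sum_const, nsmul_eq_mul]
    linarith
  obtain ⟨f, hf⟩ := exists_apply_head_le_add (S := Set.univ)
    (fun _ _ h => h.symm fun _ _ => trivial)
    (fun a _ _ => by rw [ofCoord_rev]; linarith) fun C hC _ => hcircuit C hC
  refine ⟨y - G.grad f, mem_unitCube_iff.2 fun a => ?_, ?_⟩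
  · rw [map_sub, Pi.sub_apply, ofCoord_grad]
    linarith [hf a trivial]
  · rw [map_sub, proj_grad, sub_zero, Submodule.starProjection_eq_self_iff.2 hy]

lemma proj_mem_voronoiCell {y : EuclideanSpace ℝ E} (hy : y ∈ unitCube E) :
    G.proj y ∈ G.voronoiCell := by
  refine ⟨Submodule.starProjection_apply_mem _ _, fun m hm => norm_le_norm_sub_iff.2 ?_⟩
  rw [Submodule.inner_starProjection_left_eq_right, Submodule.starProjection_eq_self_iff.2 hm.1]
  exact two_mul_inner_le_norm_sq hy hm.2

lemma voronoiCell_eq_proj_image_unitCube : G.voronoiCell = G.proj '' unitCube E :=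
  voronoiCell_subset_proj_image_unitCube.antisymm <|
    Set.image_subset_iff.2 fun _ => proj_mem_voronoiCell

lemma isCoveringBound_iff_unitCube [DecidableEq V] {r : ℝ} :
    G.IsCoveringBound r ↔ ∀ y ∈ unitCube E, ‖G.proj y‖ ^ 2 ≤ r := by
  rw [isCoveringBound_iff_voronoiCell, voronoiCell_eq_proj_image_unitCube, Set.forall_mem_image]

end Cube

section MaximalVertex

lemma eq_zero_of_norm_add_le_of_norm_sub_le {F : Type*} [NormedAddCommGroup F]
    [InnerProductSpace ℝ F] {x w : F} (hadd : ‖x + w‖ ≤ ‖x‖) (hsub : ‖x - w‖ ≤ ‖x‖) : w = 0 := by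
  rw [← sq_le_sq₀ (norm_nonneg _) (norm_nonneg _)] at hadd hsub
  rw [norm_add_sq_real] at hadd
  rw [norm_sub_sq_real] at hsub
  exact norm_eq_zero.1 <| pow_eq_zero_iff two_ne_zero |>.1 <|
    le_antisymm (by linarith) (sq_nonneg _)

variable [Fintype E] {s : EuclideanSpace ℝ E}

open Classical in
/-- The oriented non-bridge edges on which the vertex `s` of the unit cube is positive. -/
noncomputable def vertexOrientation (G : MultiG V E) (s : EuclideanSpace ℝ E) :
    Finset (OEdge E) :=
  Finset.univ.filter fun a => ¬ G.IsBridge a.1 ∧ ofCoord s a = 1 / 2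

lemma mem_vertexOrientation {a : OEdge E} :
    a ∈ G.vertexOrientation s ↔ ¬ G.IsBridge a.1 ∧ ofCoord s a = 1 / 2 := by
  simp [vertexOrientation]

lemma exists_mem_unitCube_eq_add_grad {f : V → ℝ} (hs : s ∈ unitCube E)
    (hf : ∀ e, ¬ G.IsBridge e → |s e + G.grad f e| ≤ 1 / 2) :
    ∃ z ∈ unitCube E, G.proj z = G.proj s ∧ ∀ e, ¬ G.IsBridge e → z e = s e + G.grad f e := by
  classical
  let z : EuclideanSpace ℝ E :=
    WithLp.toLp 2 fun e => if G.IsBridge e then s e else s e + G.grad f e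
  have hz (e) (he : ¬ G.IsBridge e) : z e = s e + G.grad f e := if_neg he
  refine ⟨z, fun e => ?_, ?_, hz⟩
  · by_cases he : G.IsBridge e
    · exact (congrArg abs (if_pos he : z e = s e)).trans_le (hs e)
    · exact hz e he ▸ hf e he
  · rw [proj_congr (z := s + G.grad f) hz, map_add, proj_grad, add_zero]

/-- If a maximal vertex `s` could be moved across a cut `f`, to a point with the same projection
in which some coordinate has changed sign, then flipping that coordinate in `s` and in the new
point would move the projection by opposite vectors, one of which increases its norm. -/
lemma grad_eq_zero_of_maximal {f : V → ℝ} (hs : ∀ e, |s e| = 1 / 2)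
    (hmax : ∀ y ∈ unitCube E, ‖G.proj y‖ ≤ ‖G.proj s‖)
    (hf : ∀ e, ¬ G.IsBridge e → G.grad f e = 0 ∨ G.grad f e = -2 * s e) {e : E}
    (he : ¬ G.IsBridge e) : G.grad f e = 0 := by
  classical
  have hs_mem : s ∈ unitCube E := fun e => (hs e).le
  obtain ⟨z, hz, hproj, hz_apply⟩ := exists_mem_unitCube_eq_add_grad (f := f) hs_mem fun e he => by
    rcases hf e he with h | h <;> rw [h]
    · rw [add_zero, hs e]
    · rw [← hs e, ← abs_neg (s e)]
      exact (congrArg abs (by ring)).le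
  refine (hf e he).resolve_right fun hflip => he ?_
  have hs_zero : 2 * s e ≠ 0 := mul_ne_zero two_ne_zero (by rw [← abs_pos, hs e]; norm_num)
  have hsub := hmax _ (sub_two_mul_single_mem_unitCube hs_mem e)
  have hadd := hmax _ (sub_two_mul_single_mem_unitCube hz e)
  rw [hz_apply e he, hflip, show 2 * (s e + -2 * s e) = -(2 * s e) by ring, map_sub, hproj,
    neg_smul, map_neg, sub_neg_eq_add] at hadd
  rw [map_sub] at hsub
  have hzero := eq_zero_of_norm_add_le_of_norm_sub_le hadd hsub
  rw [map_smul, smul_eq_zero_iff_right hs_zero] at hzero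
  exact proj_single_eq_zero_iff.1 hzero

lemma isStrongOrientation_vertexOrientation (hs : ∀ e, |s e| = 1 / 2)
    (hmax : ∀ y ∈ unitCube E, ‖G.proj y‖ ≤ ‖G.proj s‖) :
    G.IsStrongOrientation (G.vertexOrientation s) where
  not_bridge a ha := (mem_vertexOrientation.1 ha).1
  exactly_one e he := by
    simp only [mem_vertexOrientation, ofCoord_true, ofCoord_false, he, not_false_eq_true, true_and]
    rcases eq_or_eq_neg_of_abs_eq (hs e) with h | h
    · exact .inl ⟨h, by rw [h]; norm_num⟩
    · exact .inr ⟨by rw [h]; norm_num, by rw [h]; norm_num⟩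
  strong u v hreach := by
    set D := G.vertexOrientation s
    by_contra hnot
    have hgrad (e) (he : ¬ G.IsBridge e) :
        G.grad (G.reachIndicator D u) e = 0 ∨ G.grad (G.reachIndicator D u) e = -2 * s e := by
      rcases eq_or_eq_neg_of_abs_eq (hs e) with h | h
      · have hmem : (e, true) ∈ D := mem_vertexOrientation.2 ⟨he, h⟩
        have := ofCoord_grad_reachIndicator (G := G) (S := D) (u := u) hmem
        rw [ofCoord_true] at this
        rw [h]
        norm_num [this]
      · have hmem : (e, false) ∈ D :=
          mem_vertexOrientation.2 ⟨he, by rw [ofCoord_false, h, neg_neg]⟩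
        have := ofCoord_grad_reachIndicator (G := G) (S := D) (u := u) hmem
        rw [ofCoord_false, neg_eq_zero, neg_inj] at this
        rw [h]
        norm_num [this]
    have hconst := hreach.apply_eq (f := G.reachIndicator D u) fun a ha => by
      rw [← sub_eq_zero, ← ofCoord_grad, ← abs_eq_zero, abs_ofCoord, abs_eq_zero]
      exact grad_eq_zero_of_maximal hs hmax hgrad ha
    rw [reachIndicator_of_reach .refl, reachIndicator_of_not_reach hnot] at hconst
    exact one_ne_zero hconst

end MaximalVertex

section CoveringNumber

variable [Fintype E]

lemma exists_isStrongOrientation_forall_norm_proj_le [DecidableEq E] (G : MultiG V E) :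
    ∃ D, G.IsStrongOrientation D ∧
      ∀ y ∈ unitCube E, ‖G.proj y‖ ≤ ‖G.proj ((1 / 2 : ℝ) • signVec D)‖ := by
  obtain ⟨s, hs, hmax⟩ :=
    exists_vertex_forall_le (convexOn_univ_norm.comp_linearMap G.proj.toLinearMap)
  have hD := isStrongOrientation_vertexOrientation hs hmax
  refine ⟨_, hD, fun y hy => (hmax y hy).trans_eq (congrArg norm ?_)⟩
  refine hD.proj_congr_of_mem fun a ha => ?_
  rw [map_smul, Pi.smul_apply, ofCoord_signVec_of_mem hD.rev_notMem ha, smul_eq_mul, mul_one,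
    (mem_vertexOrientation.1 ha).2]

variable [DecidableEq V] {D : Finset (OEdge E)}

lemma isLeast_norm_proj_half_signVec_sq [DecidableEq E]
    (hmax : ∀ y ∈ unitCube E, ‖G.proj y‖ ≤ ‖G.proj ((1 / 2 : ℝ) • signVec D)‖) :
    IsLeast {r | G.IsCoveringBound r} (‖G.proj ((1 / 2 : ℝ) • signVec D)‖ ^ 2) :=
  ⟨isCoveringBound_iff_unitCube.2 fun y hy => pow_le_pow_left₀ (norm_nonneg _) (hmax y hy) 2,
    fun _ hr => isCoveringBound_iff_unitCube.1 hr _ (half_signVec_mem_unitCube D)⟩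

lemma isLeast_coveringNumber (G : MultiG V E) :
    IsLeast {r | G.IsCoveringBound r} G.coveringNumber := by
  classical
  obtain ⟨D, -, hmax⟩ := G.exists_isStrongOrientation_forall_norm_proj_le
  have hleast := isLeast_norm_proj_half_signVec_sq hmax
  rwa [← hleast.csInf_eq] at hleast

lemma exists_isStrongOrientation_coveringNumber_eq [DecidableEq E] (G : MultiG V E) :
    ∃ D, G.IsStrongOrientation D ∧
      G.coveringNumber = ‖G.proj ((1 / 2 : ℝ) • signVec D)‖ ^ 2 := by
  obtain ⟨D, hD, hmax⟩ := G.exists_isStrongOrientation_forall_norm_proj_le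
  exact ⟨D, hD, (isLeast_norm_proj_half_signVec_sq hmax).csInf_eq⟩

lemma norm_proj_half_signVec_sq_le_coveringNumber [DecidableEq E] (G : MultiG V E)
    (D : Finset (OEdge E)) : ‖G.proj ((1 / 2 : ℝ) • signVec D)‖ ^ 2 ≤ G.coveringNumber :=
  isCoveringBound_iff_unitCube.1 G.isLeast_coveringNumber.1 _ (half_signVec_mem_unitCube D)

lemma IsStrongOrientation.existsUnique_isOrientationFlow [DecidableEq E]
    (hD : G.IsStrongOrientation D) : ∃! x, G.IsOrientationFlow D x := by
  simp only [hD.isOrientationFlow_iff, existsUnique_eq]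

lemma IsStrongOrientation.quad_eq_of_isOrientationFlow [DecidableEq E]
    (hD : G.IsStrongOrientation D) {x : OEdge E → ℝ} (hx : G.IsOrientationFlow D x) :
    quad x = ‖G.proj ((1 / 2 : ℝ) • signVec D)‖ ^ 2 := by
  rw [hD.isOrientationFlow_iff.1 hx, quad_eq_norm_sq, coord_ofCoord]

lemma isGreatest_coveringNumber [DecidableEq E] (G : MultiG V E) :
    IsGreatest {t | ∃ D x, G.IsStrongOrientation D ∧ G.IsOrientationFlow D x ∧ t = quad x}
      G.coveringNumber := by
  refine ⟨?_, ?_⟩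
  · obtain ⟨D, hD, hcov⟩ := G.exists_isStrongOrientation_coveringNumber_eq
    obtain ⟨x, hx, -⟩ := hD.existsUnique_isOrientationFlow
    exact ⟨D, x, hD, hx, by rw [hD.quad_eq_of_isOrientationFlow hx, hcov]⟩
  · rintro _ ⟨D, x, hD, hx, rfl⟩
    rw [hD.quad_eq_of_isOrientationFlow hx]
    exact G.norm_proj_half_signVec_sq_le_coveringNumber D

variable [Fintype V] {f : V → ℝ}

lemma IsStrongOrientation.le_coveringNumber (hD : G.IsStrongOrientation D)
    (hf : G.IsPotential D f) :
    (G.numNonBridge : ℝ) / 4 - G.energy f / 4 ≤ G.coveringNumber := by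
  classical
  rw [← hD.norm_proj_half_signVec_sq hf]
  exact G.norm_proj_half_signVec_sq_le_coveringNumber D

lemma exists_isPotential_coveringNumber_eq (G : MultiG V E) :
    ∃ D f, G.IsStrongOrientation D ∧ G.IsPotential D f ∧
      G.coveringNumber = (G.numNonBridge : ℝ) / 4 - G.energy f / 4 := by
  classical
  obtain ⟨D, hD, hcov⟩ := G.exists_isStrongOrientation_coveringNumber_eq
  obtain ⟨f, hf⟩ := G.exists_isPotential D
  exact ⟨D, f, hD, hf, hcov.trans (hD.norm_proj_half_signVec_sq hf)⟩

lemma IsPotential.energy_eq {f' : V → ℝ} (hf : G.IsPotential D f) (hf' : G.IsPotential D f') :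
    G.energy f = G.energy f' := by
  classical
  rw [energy_eq_norm_sq, energy_eq_norm_sq, isPotential_iff.1 hf, isPotential_iff.1 hf']

lemma exists_isWellBalanced (G : MultiG V E) : ∃ D, G.IsWellBalanced D := by
  obtain ⟨D, f, hD, hf, hcov⟩ := G.exists_isPotential_coveringNumber_eq
  refine ⟨D, hD, f, hf, fun D' f' hD' hf' => ?_⟩
  linarith [hD'.le_coveringNumber hf']

lemma IsWellBalanced.coveringNumber_eq (hD : G.IsWellBalanced D) (hf : G.IsPotential D f) :
    G.coveringNumber = (G.numNonBridge : ℝ) / 4 - G.energy f / 4 := by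
  obtain ⟨hstrong, f₀, hf₀, hmin⟩ := hD
  obtain ⟨D', f', hD', hf', hcov⟩ := G.exists_isPotential_coveringNumber_eq
  linarith [hmin D' f' hD' hf', hstrong.le_coveringNumber hf, hf.energy_eq hf₀]

end CoveringNumber

section Eulerian

lemma Reach.exists_intVector [Fintype E] {S : Set (OEdge E)} {u v : V} (h : G.Reach S u v) :
    ∃ p ∈ intVectors E, ∀ f, inner ℝ (G.grad f) p = f u - f v := by
  classical
  induction h with
  | refl => exact ⟨0, zero_mem _, by simp⟩
  | tail _ h ih =>
    obtain ⟨a, -, rfl, rfl⟩ := h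
    obtain ⟨p, hp, hinner⟩ := ih
    refine ⟨p + signVec {a}, add_mem hp (signVec_mem_intVectors _), fun f => ?_⟩
    rw [inner_add_right, hinner, inner_signVec, Finset.sum_singleton, ofCoord_grad]
    ring

variable [Fintype E]

lemma exists_intVector_inner_grad_eq {T : Finset V} {k : V → ℤ}
    (hk : ∀ f, G.grad f = 0 → ∑ v ∈ T, f v * k v = 0) :
    ∃ p ∈ intVectors E, ∀ f, inner ℝ (G.grad f) p = ∑ v ∈ T, f v * k v := by
  obtain ⟨root, hroot, hconst⟩ := exists_root (G := G) (S := Set.univ)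
    fun _ _ h => h.symm fun _ _ => trivial
  choose p hp hinner using fun v => (hroot v).exists_intVector
  refine ⟨-∑ v ∈ T, k v • p v, neg_mem (sum_mem fun v _ => zsmul_mem (hp v) _), fun f => ?_⟩
  have hzero := hk (f ∘ root) (grad_eq_zero_iff.2 fun u v h => congrArg f (hconst u v h))
  simp only [inner_neg_right, inner_sum, ← Int.cast_smul_eq_zsmul ℝ, inner_smul_right, hinner]
  rw [← sub_zero (∑ v ∈ T, f v * (k v : ℝ)), ← hzero, ← Finset.sum_sub_distrib,
    ← Finset.sum_neg_distrib]
  exact Finset.sum_congr rfl fun v _ => by simp only [Function.comp_apply]; ring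

variable [DecidableEq V]

lemma IsEulerian.exists_divergence_eq_two_mul (hG : G.IsEulerian) :
    ∃ k : V → ℤ, ∀ v, ∑ a with G.tail a = v, ofCoord (coord 1) a = 2 * (k v : ℝ) := by
  choose j hj using hG
  refine ⟨fun v => j v - (Finset.univ.filter fun a => G.tail a = v ∧ a.2 = false).card,
    fun v => ?_⟩
  have hsign (a : OEdge E) : ofCoord (coord 1) a = 1 - 2 * if a.2 = false then 1 else 0 := by
    rcases a with ⟨e, _ | _⟩ <;> norm_num [ofCoord, coord_apply]
  simp only [hsign, Finset.sum_sub_distrib, ← Finset.mul_sum, Finset.sum_boole,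
    Finset.filter_filter, Finset.sum_const, nsmul_one, hj]
  push_cast
  ring

lemma IsEulerian.exists_odd_mem_intFlows (hG : G.IsEulerian) :
    ∃ n ∈ G.intFlows, ∀ e, ∃ k : ℤ, n e = 2 * k + 1 := by
  obtain ⟨k, hk⟩ := hG.exists_divergence_eq_two_mul
  have hone (f : V → ℝ) : inner ℝ (G.grad f) (coord 1) =
      2 * ∑ v ∈ Finset.univ.image G.tail, f v * k v := by
    rw [inner_grad, ← Finset.sum_fiberwise_of_maps_to
      fun a _ => Finset.mem_image_of_mem G.tail (Finset.mem_univ a), Finset.mul_sum]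
    refine Finset.sum_congr rfl fun v _ => ?_
    rw [mul_left_comm, ← hk, Finset.mul_sum]
    exact Finset.sum_congr rfl fun a ha => by rw [(Finset.mem_filter.1 ha).2]
  obtain ⟨p, hp, hinner⟩ := exists_intVector_inner_grad_eq (G := G)
    fun f hf => by simpa [hf] using hone f
  let n : EuclideanSpace ℝ E := coord 1 - (2 : ℝ) • p
  have hodd (e) : ∃ k : ℤ, n e = 2 * k + 1 := by
    obtain ⟨j, hj⟩ := hp e
    refine ⟨-j, ?_⟩
    rw [PiLp.sub_apply, PiLp.smul_apply, coord_apply, Pi.one_apply, smul_eq_mul, ← hj,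
      Int.coe_castAddHom]
    push_cast
    ring
  refine ⟨n, ⟨mem_flows_iff_inner.2 fun f => ?_, fun e => ?_⟩, hodd⟩
  · rw [inner_sub_right, inner_smul_right, hone, hinner, sub_self]
  · obtain ⟨j, hj⟩ := hodd e
    exact ⟨2 * j + 1, by rw [hj, Int.coe_castAddHom]; push_cast; rfl⟩

lemma one_quarter_le_half_odd_sub_sq (k j : ℤ) :
    1 / 4 ≤ ((1 / 2 : ℝ) * (2 * k + 1) - j) ^ 2 := by
  have hmul : 0 ≤ (k - j) * (k - j + 1) := by
    rcases le_or_gt 0 (k - j) with h | h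
    · positivity
    · exact mul_nonneg_of_nonpos_of_nonpos h.le h
  have hmul' : (0 : ℝ) ≤ (k - j) * (k - j + 1) := by exact_mod_cast hmul
  linarith

lemma card_div_four_le_norm_half_sub_sq {n m : EuclideanSpace ℝ E}
    (hn : ∀ e, ∃ k : ℤ, n e = 2 * k + 1) (hm : m ∈ intVectors E) :
    (Fintype.card E : ℝ) / 4 ≤ ‖(1 / 2 : ℝ) • n - m‖ ^ 2 := by
  rw [EuclideanSpace.norm_sq_eq, div_eq_mul_one_div, ← nsmul_eq_mul]
  refine Finset.card_nsmul_le_sum _ _ _ fun e _ => ?_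
  obtain ⟨k, hk⟩ := hn e
  obtain ⟨j, hj⟩ := hm e
  rw [PiLp.sub_apply, PiLp.smul_apply, hk, ← hj, Real.norm_eq_abs, sq_abs]
  exact one_quarter_le_half_odd_sub_sq k j

lemma coveringNumber_le (G : MultiG V E) : G.coveringNumber ≤ (Fintype.card E : ℝ) / 4 := by
  classical
  obtain ⟨D, -, hcov⟩ := G.exists_isStrongOrientation_coveringNumber_eq
  rw [hcov]
  exact (pow_le_pow_left₀ (norm_nonneg _) (Submodule.norm_starProjection_apply_le _ _) 2).trans
    (norm_sq_le_of_mem_unitCube (half_signVec_mem_unitCube D))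

lemma IsEulerian.coveringNumber_eq (hG : G.IsEulerian) :
    G.coveringNumber = (Fintype.card E : ℝ) / 4 := by
  refine G.coveringNumber_le.antisymm ?_
  obtain ⟨n, hn, hodd⟩ := hG.exists_odd_mem_intFlows
  obtain ⟨m, hm, hle⟩ := isCoveringBound_iff_exists.1 G.isLeast_coveringNumber.1
    ((1 / 2 : ℝ) • n) (G.flows.smul_mem _ hn.1)
  exact (card_div_four_le_norm_half_sub_sq hodd hm.2).trans hle

end Eulerian

end MultiG

theorem mainTheorem8_general {V E : Type*} [Fintype V] [DecidableEq V] [Fintype E]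
    [DecidableEq E] (G : MultiG V E) :
    IsLeast {r : ℝ | G.IsCoveringBound r} G.coveringNumber ∧
    (∀ D, G.IsStrongOrientation D → ∃! v, G.IsOrientationFlow D v) ∧
    IsGreatest {s : ℝ | ∃ D v, G.IsStrongOrientation D ∧ G.IsOrientationFlow D v ∧
      s = MultiG.quad v} G.coveringNumber ∧
    (∀ D, ∃ f, G.IsPotential D f ∧
      ∀ f', G.IsPotential D f' → ∀ y z, G.Reach Set.univ y z → f' y - f y = f' z - f z) ∧
    (∃ D, G.IsWellBalanced D) ∧
    (∀ D f, G.IsWellBalanced D → G.IsPotential D f →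
      G.coveringNumber = (G.numNonBridge : ℝ) / 4 - G.energy f / 4) ∧
    (G.IsEulerian → G.coveringNumber = (Fintype.card E : ℝ) / 4) := by
  refine ⟨G.isLeast_coveringNumber, fun D hD => hD.existsUnique_isOrientationFlow,
    G.isGreatest_coveringNumber, fun D => ?_, G.exists_isWellBalanced,
    fun D f hD hf => hD.coveringNumber_eq hf, fun hG => hG.coveringNumber_eq⟩
  obtain ⟨f, hf⟩ := G.exists_isPotential D
  exact ⟨f, hf, fun f' hf' y z h => hf.sub_eq_sub hf' h⟩

theorem mainTheorem8 {V E : Type*} [Fintype V] [DecidableEq V] [Fintype E] [DecidableEq E]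
    (G : MultiG V E) (hG : G.Connected) :
    -- the covering number is attained: it is the smallest `r` whose balls cover
    IsLeast {r : ℝ | G.IsCoveringBound r} G.coveringNumber ∧
    -- each strongly connected orientation `D` has a unique flow `v^D`
    (∀ D, G.IsStrongOrientation D → ∃! v, G.IsOrientationFlow D v) ∧
    -- the covering number is the maximum of `q (v^D)`
    IsGreatest {s : ℝ | ∃ D v, G.IsStrongOrientation D ∧ G.IsOrientationFlow D v ∧
      s = MultiG.quad v} G.coveringNumber ∧
    -- each Laplacian equation has a solution `f_D`, unique up to an additive constant
    (∀ D, G.IsStrongOrientation D → ∃ f, G.IsPotential D f ∧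
      ∀ f', G.IsPotential D f' → ∃ c : ℝ, ∀ y, f' y = f y + c) ∧
    -- well-balanced orientations exist, and each of them computes the covering number
    (∃ D, G.IsWellBalanced D) ∧
    (∀ D f, G.IsWellBalanced D → G.IsPotential D f →
      G.coveringNumber = (G.numNonBridge : ℝ) / 4 - G.energy f / 4) ∧
    -- the Eulerian case
    (G.IsEulerian → G.coveringNumber = (Fintype.card E : ℝ) / 4) := by
  obtain ⟨hleast, hflow, hgreatest, hpotential, hbalanced, heuler⟩ := mainTheorem8_general G
  refine ⟨hleast, hflow, hgreatest, fun D _ => ?_, hbalanced, heuler⟩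
  obtain ⟨f, hf, hconst⟩ := hpotential D
  obtain ⟨v₀⟩ := hG.1
  exact ⟨f, hf, fun f' hf' => ⟨f' v₀ - f v₀, fun y => by
    linarith [hconst f' hf' y v₀ (hG.2 y v₀)]⟩⟩
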